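/- Setting. All LTI systems are discrete-time, causal, finite-dimensional and real, given by $x_{k+1}=Ax_k+Bu_k$, $y_k=Cx_k+Du_k$, with transfer function $D+C(zI-A)^{-1}B$ and impulse response $g_0=D$, $g_k=CA^{k-1}B$ for $k\ge 1$; such a system is called stable if all eigenvalues of $A$ have modulus less than $1$. For a SISO transfer function $F$ without poles on the unit circle, $\|F\|_\infty=\sup_{|z|=1}|F(z)|$. Let $G$ be a SISO LTI system, given by a minimal realization, and let $\Psi=\begin{pmatrix}\Psi_{11}&\Psi_{12}\\ \Psi_{21}&\Psi_{22}\end{pmatrix}$ be a stable LTI system with two inputs and two outputs and impulse response $g^\Psi$. For a trajectory $(u,y)$ of $G$ put $r_k=\bigl(g^{\Psi}\star\binom{u}{y}\bigr)_k=\sum_{j=0}^{k}g^{\Psi}_{k-j}\binom{u_j}{y_j}$. For a symmetric $M\in\mathbb R^{2\times2}$ and an integer $L\ge1$, $G$ satisfies the $L$-IQC given by $\Psi^\sim M\Psi$ if $\sum_{k=0}^{h}r_k^\top Mr_k\ge0$ for all $h=0,\dots,L-1$ and all trajectories $\{u_k,y_k\}_{k=0}^{L-1}$ of $G$ with initial state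 $x_0=0$; it satisfies the (infinite-horizon) IQC given by $\Psi^\sim M\Psi$ if $\sum_{k=0}^{h}r_k^\top Mr_k\ge0$ for all $h\ge0$ and all trajectories $\{u_k,y_k\}_{k=0}^{\infty}$ of $G$ with $x_0=0$ and $u\in\ell_2$. Theorem. Assume that $G$ is stable, that $\Psi_{11}$ has a stable causal inverse $\Psi_{11}^{-1}$ (a stable LTI system whose input-output map from zero initial state is inverse to that of $\Psi_{11}$), and that $\|\Psi_{12}G\Psi_{11}^{-1}\|_\infty<1$. Then there is a sequence $\epsilon_L\ge0$, depending only on $G$ and $\Psi$, with $\epsilon_L=\mathcal O(1/L^2)$ as $L\to\infty$, such that for every integer $L\ge1$ and every $\gamma\ge0$: if $G$ satisfies the $L$-IQC given by $\Psi^\sim M\Psi$ with $M=\begin{pmatrix}\gamma^2&0\\0&-1\end{pmatrix}$, then $G$ satisfies the infinite-horizon IQC given by $\Psi^\sim M_{\inf}\Psi$ with $M_{\inf}=\begin{pmatrix}(\gamma+\epsilon_L)^2&0\\0&-1\end{pmatrix}$. -/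

import Mathlib

open Filter Asymptotics
open scoped Matrix

noncomputable section

/-- A finite-dimensional causal discrete-time LTI system with `n` states, inputs indexed by `m`
and outputs indexed by `p`, given by a real state-space realization
`x (k+1) = A x k + B u k`, `y k = C x k + D u k`. -/
structure LTISystem (n : ℕ) (m p : Type) where
  A : Matrix (Fin n) (Fin n) ℝ
  B : Matrix (Fin n) m ℝ
  C : Matrix p (Fin n) ℝ
  D : Matrix p m ℝ

namespace LTISystem

variable {n : ℕ} {m p m' p' r : Type}

/-- The impulse response `D, C B, C A B, C A² B, …`. -/
def impulse (S : LTISystem n m p) : ℕ → Matrix p m ℝ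
  | 0 => S.D
  | k + 1 => S.C * S.A ^ k * S.B

/-- Asymptotic stability: every complex eigenvalue of `A` lies in the open unit disc. -/
def IsStable (S : LTISystem n m p) : Prop :=
  ∀ μ ∈ spectrum ℂ (S.A.map Complex.ofReal), ‖μ‖ < 1

/-- The realization is minimal: no realization of the same input-output map
has fewer states. -/
def IsMinimal (S : LTISystem n m p) : Prop :=
  ∀ (n' : ℕ) (S' : LTISystem n' m p), S'.impulse = S.impulse → n ≤ n'

/-- The transfer function `z ↦ D + C (z I - A)⁻¹ B`. -/
def transfer (S : LTISystem n m p) (z : ℂ) : Matrix p m ℂ :=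
  S.D.map Complex.ofReal +
    S.C.map Complex.ofReal * (z • (1 : Matrix (Fin n) (Fin n) ℂ) - S.A.map Complex.ofReal)⁻¹ *
      S.B.map Complex.ofReal

/-- The subsystem with the inputs selected by `i` and the outputs selected by `o`. -/
def block (S : LTISystem n m p) (o : p' → p) (i : m' → m) : LTISystem n m' p' where
  A := S.A
  B := S.B.submatrix id i
  C := S.C.submatrix o id
  D := S.D.submatrix o i

/-- `(u, y)` restricted to the times `k < N` is a trajectory of `S` with initial condition `x₀`;
for `N = ⊤` this concerns all times. -/
def IsTrajectory [Fintype m] (S : LTISystem n m p) (N : ℕ∞) (x₀ : Fin n → ℝ)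
    (u : ℕ → m → ℝ) (y : ℕ → p → ℝ) : Prop :=
  ∃ x : ℕ → Fin n → ℝ, x 0 = x₀ ∧ ∀ k : ℕ, (k : ℕ∞) < N →
    x (k + 1) = S.A *ᵥ x k + S.B *ᵥ u k ∧ y k = S.C *ᵥ x k + S.D *ᵥ u k

/-- The response to the signal `w` with zero initial condition, i.e. the convolution of the
impulse response with `w`. -/
def filter [Fintype m] (S : LTISystem n m p) (w : ℕ → m → ℝ) (k : ℕ) : p → ℝ :=
  ∑ j ∈ Finset.range (k + 1), S.impulse (k - j) *ᵥ w j

/-- The input-output maps of `S` and `T` (on arbitrary signals, with zero initial condition)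
are inverse to each other. -/
def IsInverse {n' : ℕ} [Fintype m] [Fintype p] (T : LTISystem n' p m) (S : LTISystem n m p) :
    Prop :=
  (∀ w, T.filter (S.filter w) = w) ∧ ∀ v, S.filter (T.filter v) = v

/-- The signal `r = g ⋆ (u, y)`, where `g` is the impulse response of `Ψ`. -/
def filteredSignal {l : ℕ} [Fintype m] [Fintype p] (Ψ : LTISystem l (m ⊕ p) r)
    (u : ℕ → m → ℝ) (y : ℕ → p → ℝ) : ℕ → r → ℝ :=
  Ψ.filter fun k => Sum.elim (u k) (y k)

/-- `G` satisfies the `L`-IQC given by the factorized multiplier `Ψ~ M Ψ`. -/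
def SatisfiesFiniteIQC {l : ℕ} [Fintype m] [Fintype p] [Fintype r] (G : LTISystem n m p)
    (Ψ : LTISystem l (m ⊕ p) r) (M : Matrix r r ℝ) (L : ℕ) : Prop :=
  ∀ (u : ℕ → m → ℝ) (y : ℕ → p → ℝ), G.IsTrajectory L 0 u y → ∀ h < L,
    0 ≤ ∑ k ∈ Finset.range (h + 1),
      filteredSignal Ψ u y k ⬝ᵥ M *ᵥ filteredSignal Ψ u y k

/-- `G` satisfies the (infinite-horizon) IQC given by the factorized multiplier `Ψ~ M Ψ`. -/
def SatisfiesIQC {l : ℕ} [Fintype m] [Fintype p] [Fintype r] (G : LTISystem n m p)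
    (Ψ : LTISystem l (m ⊕ p) r) (M : Matrix r r ℝ) : Prop :=
  ∀ (u : ℕ → m → ℝ) (y : ℕ → p → ℝ), (Summable fun k => u k ⬝ᵥ u k) →
    G.IsTrajectory ⊤ 0 u y → ∀ h : ℕ,
      0 ≤ ∑ k ∈ Finset.range (h + 1),
        filteredSignal Ψ u y k ⬝ᵥ M *ᵥ filteredSignal Ψ u y k

/-- The scalar transfer function of a SISO system. -/
def sisoTransfer (S : LTISystem n (Fin 1) (Fin 1)) (z : ℂ) : ℂ := S.transfer z 0 0

end LTISystem

/-- The `H∞` norm of a scalar transfer function that is continuous on the unit circle: its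
supremum there, in `[0, ∞]`. -/
def hInfNorm (F : ℂ → ℂ) : ENNReal := ⨆ z : Circle, ‖F z‖ₑ

/-- The matrix `diag(γ², -1)`. -/
def gainMatrix (γ : ℝ) : Matrix (Fin 1 ⊕ Fin 1) (Fin 1 ⊕ Fin 1) ℝ :=
  Matrix.fromBlocks ((γ ^ 2) • 1) 0 0 (-1)

end

/-! From zero initial state the two components of `r` are `Q u` and `E u`, with `Q = Ψ₁₁ + Ψ₁₂ G`
and `E = Ψ₂₁ + Ψ₂₂ G` read as power series in the delay. Since `Q = (1 + Ψ₁₂ G Ψ₁₁⁻¹) Ψ₁₁`, the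
small-gain condition yields an exponentially decaying inverse `T` of `Q`
(`exists_inverse_filteredSeries`). Substituting `u = T v` turns both IQCs into gain bounds for
finite sections of the causal Toeplitz operator `H = E T`: length `L` on one side, all lengths on
the other.

The comparison is `toeplitz_gain_le`. Cut `v` by all translates `w_s` of a tent of length `L` and
apply the section bound to each `w_s v`. The sum `R` of `w_s(p)²` over `s` does not depend on `p`
and is of order `L³`. By polarization, the sum over `s` of `|H(w_s v)|²` differs from `R |H v|²`
only through the sums of `(w_s(p) - w_s(q))²`, which are `O(L (p - q)²)`. The output spilling out of
the windows also costs `O(L)`, because the tent is small near its ends. Decay of `H` absorbs the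
polynomial weights, so the squared gain changes by `O(L / L³)`. Passing to the gain itself needs a
lower bound on `γ`, supplied by a nonzero coefficient of `H` (`exists_truncated_gain_le`). -/

/-! ### Tent windows and their translates -/

/-- The tent window supported on `{0, …, L - 1}`. -/
noncomputable def tentWindow (L : ℕ) (x : ℤ) : ℝ := max 0 (min ((x : ℝ) + 1) (L - x))

theorem tentWindow_eq_zero {L : ℕ} {x : ℤ} (hx : x ∉ Finset.Ico (0 : ℤ) L) :
    tentWindow L x = 0 := by
  apply max_eq_left
  by_cases h : x < 0
  · refine (min_le_left _ _).trans ?_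
    exact_mod_cast (show x + 1 ≤ 0 by lia)
  · refine (min_le_right _ _).trans ?_
    have : (L : ℤ) ≤ x := by simp at hx; lia
    have : (L : ℝ) ≤ x := by exact_mod_cast this
    linarith

theorem abs_tentWindow_sub_le (L : ℕ) (x y : ℤ) :
    |tentWindow L x - tentWindow L y| ≤ |(x : ℝ) - y| := by
  refine (abs_max_sub_max_le_max _ _ _ _).trans (max_le (by simp) ?_)
  refine (abs_min_sub_min_le_max _ _ _ _).trans (max_le (le_of_eq ?_) (le_of_eq ?_))
  · congr 1; ring
  · rw [abs_sub_comm]; congr 1; ring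

theorem Finset.sum_Ico_zero_natCast (f : ℤ → ℝ) (m : ℕ) :
    ∑ x ∈ Finset.Ico (0 : ℤ) m, f x = ∑ k ∈ Finset.range m, f k := by
  symm
  refine Finset.sum_nbij' (fun x : ℕ => (x : ℤ)) Int.toNat ?_ ?_ ?_ ?_ ?_ <;>
    simp +contextual

/-- The tent dominates the parabola `(x + 1)(L - x)/(L + 1)`, and `w² ≥ (L/2) w - (L/4)²` linearizes
the square, so a closed form for the sum of the parabola suffices: `L³/12 - L³/16 = L³/48`. -/
theorem le_sum_sq_tentWindow (L : ℕ) :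
    (L : ℝ) ^ 3 / 48 ≤ ∑ x ∈ Finset.Ico (0 : ℤ) L, tentWindow L x ^ 2 := by
  rcases Nat.eq_zero_or_pos L with rfl | hL
  · simp
  have hL1 : (1 : ℝ) ≤ L := by exact_mod_cast hL
  have hprod : ∀ N : ℕ, ∑ x ∈ Finset.range N, ((x : ℝ) + 1) * (L - x) =
      N * (N + 1) * (3 * L - 2 * N + 2) / 6 := by
    intro N
    induction N with
    | zero => simp
    | succ N ih => rw [Finset.sum_range_succ, ih]; push_cast; ring
  have hterm : ∀ x ∈ Finset.range L,
      (L : ℝ) / 2 * (((x : ℝ) + 1) * (L - x) / (L + 1)) - (L / 4) ^ 2 ≤ tentWindow L x ^ 2 := by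
    intro x hx
    have hxL : (x : ℝ) + 1 ≤ L := by exact_mod_cast Finset.mem_range.1 hx
    have hx0 : (0 : ℝ) ≤ x := x.cast_nonneg
    have hw : ((x : ℝ) + 1) * (L - x) / (L + 1) ≤ tentWindow L x := by
      refine le_max_of_le_right (le_min ?_ ?_) <;> rw [div_le_iff₀ (by positivity)] <;>
        push_cast <;> nlinarith
    nlinarith [sq_nonneg (tentWindow L x - L / 4)]
  rw [Finset.sum_Ico_zero_natCast]
  refine le_trans ?_ (Finset.sum_le_sum hterm)
  rw [Finset.sum_sub_distrib, ← Finset.mul_sum, ← Finset.sum_div, hprod]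
  have : (L : ℝ) * (L + 1) * (3 * L - 2 * L + 2) / 6 / (L + 1) = L * (L + 2) / 6 := by
    field_simp; ring
  rw [this]
  simp
  nlinarith [pow_pos (zero_lt_one.trans_le hL1) 2]

/-- The number of shifted windows that see a given point. -/
theorem sum_indicator_window_le (L : ℕ) (S : Finset ℤ) (p : ℤ) :
    ∑ s ∈ S, (if s ∈ Finset.Ioc (p - L) p then (1 : ℝ) else 0) ≤ L := by
  rw [Finset.sum_ite_mem, Finset.sum_const, nsmul_eq_mul, mul_one]
  have : (S ∩ Finset.Ioc (p - L) p).card ≤ L :=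
    (Finset.card_le_card Finset.inter_subset_right).trans (by simp)
  exact_mod_cast this

theorem tentWindow_sub_eq_zero {L : ℕ} {p s : ℤ} (h : s ∉ Finset.Ioc (p - L) p) :
    tentWindow L (p - s) = 0 := by
  apply tentWindow_eq_zero
  simp at h ⊢; lia

theorem sum_sq_tentWindow_sub (L : ℕ) {S : Finset ℤ} {p : ℤ} (hS : Finset.Ioc (p - L) p ⊆ S) :
    ∑ s ∈ S, tentWindow L (p - s) ^ 2 = ∑ x ∈ Finset.Ico (0 : ℤ) L, tentWindow L x ^ 2 := by
  rw [← Finset.sum_subset hS fun s _ hs => by rw [tentWindow_sub_eq_zero hs]; simp]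
  refine Finset.sum_nbij' (fun s => p - s) (fun x => p - x) ?_ ?_ ?_ ?_ ?_ <;>
    simp <;> intros <;> lia

/-- The tent is 1-Lipschitz, and at most `2 L` translates see `p` or `q`. -/
theorem sum_sq_tentWindow_sub_sub_le (L : ℕ) (S : Finset ℤ) (p q : ℤ) :
    ∑ s ∈ S, (tentWindow L (p - s) - tentWindow L (q - s)) ^ 2 ≤
      2 * L * ((p : ℝ) - q) ^ 2 := by
  have hterm : ∀ s ∈ S, (tentWindow L (p - s) - tentWindow L (q - s)) ^ 2 ≤
      ((p : ℝ) - q) ^ 2 * ((if s ∈ Finset.Ioc (p - L) p then (1 : ℝ) else 0) +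
        if s ∈ Finset.Ioc (q - L) q then (1 : ℝ) else 0) := by
    intro s _
    by_cases h : s ∈ Finset.Ioc (p - L) p ∨ s ∈ Finset.Ioc (q - L) q
    · have h1 : (tentWindow L (p - s) - tentWindow L (q - s)) ^ 2 ≤ ((p : ℝ) - q) ^ 2 := by
        rw [sq_le_sq]
        simpa using abs_tentWindow_sub_le L (p - s) (q - s)
      refine h1.trans (le_mul_of_one_le_right (sq_nonneg _) ?_)
      rcases h with h | h <;> rw [if_pos h] <;> split_ifs <;> norm_num
    · rw [not_or] at h
      rw [tentWindow_sub_eq_zero h.1, tentWindow_sub_eq_zero h.2, if_neg h.1, if_neg h.2]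
      simp
  refine (Finset.sum_le_sum hterm).trans ?_
  rw [← Finset.mul_sum, Finset.sum_add_distrib]
  nlinarith [sum_indicator_window_le L S p, sum_indicator_window_le L S q,
    sq_nonneg ((p : ℝ) - q)]

/-! ### Localization and finite Toeplitz sections -/

/-- The localization identity for a family of windows whose squares add up to a constant. -/
theorem sum_sq_sum_mul_window {ι κ : Type*} (P : Finset ι) (S : Finset κ) (w : ι → κ → ℝ) (R : ℝ)
    (hR : ∀ p ∈ P, ∑ s ∈ S, w p s ^ 2 = R) (c : ι → ℝ) :
    ∑ s ∈ S, (∑ p ∈ P, c p * w p s) ^ 2 = R * (∑ p ∈ P, c p) ^ 2 -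
      1 / 2 * ∑ p ∈ P, ∑ q ∈ P, c p * c q * ∑ s ∈ S, (w p s - w q s) ^ 2 := by
  -- Polarization: the deviation from `R` is quadratic in `w p - w q`, with no first-order term.
  -- This is the source of the rate `1 / L ^ 2`.
  have hpq : ∀ p ∈ P, ∀ q ∈ P, ∑ s ∈ S, w p s * w q s =
      R - 1 / 2 * ∑ s ∈ S, (w p s - w q s) ^ 2 := by
    intro p hp q hq
    have : ∑ s ∈ S, (w p s - w q s) ^ 2 =
        ∑ s ∈ S, w p s ^ 2 + ∑ s ∈ S, w q s ^ 2 - 2 * ∑ s ∈ S, w p s * w q s := by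
      rw [Finset.mul_sum, ← Finset.sum_add_distrib, ← Finset.sum_sub_distrib]
      exact Finset.sum_congr rfl fun s _ => by ring
    rw [this, hR p hp, hR q hq]; ring
  calc ∑ s ∈ S, (∑ p ∈ P, c p * w p s) ^ 2
      = ∑ p ∈ P, ∑ q ∈ P, c p * c q * ∑ s ∈ S, w p s * w q s := by
        simp_rw [sq, Finset.sum_mul_sum, Finset.mul_sum]
        rw [Finset.sum_comm]
        refine Finset.sum_congr rfl fun p _ => ?_
        rw [Finset.sum_comm]
        exact Finset.sum_congr rfl fun q _ => Finset.sum_congr rfl fun s _ => by ring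
    _ = ∑ p ∈ P, ∑ q ∈ P, (R * (c p * c q) -
          1 / 2 * (c p * c q * ∑ s ∈ S, (w p s - w q s) ^ 2)) :=
        Finset.sum_congr rfl fun p hp => Finset.sum_congr rfl fun q hq => by
          rw [hpq p hp q hq]; ring
    _ = _ := by
        simp_rw [Finset.sum_sub_distrib, ← Finset.mul_sum]
        rw [sq, Finset.sum_mul_sum]
        simp_rw [← Finset.mul_sum]

/-- A finite form of Young's convolution inequality. -/
theorem sum_sq_convolution_le (P : Finset ℤ) (b v : ℤ → ℝ) (hb : ∀ x, 0 ≤ b x) (B : ℝ)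
    (hB : ∀ T : Finset ℤ, ∑ x ∈ T, b x ≤ B) :
    ∑ k ∈ P, (∑ p ∈ P, b (k - p) * |v p|) ^ 2 ≤ B ^ 2 * ∑ p ∈ P, v p ^ 2 := by
  have hB0 : 0 ≤ B := by simpa using hB ∅
  have hrow : ∀ k, ∑ p ∈ P, b (k - p) ≤ B := fun k => by
    have := hB (P.map ⟨fun p => k - p, fun _ _ h => by simpa using h⟩)
    simpa [Finset.sum_map] using! this
  have hcol : ∀ p, ∑ k ∈ P, b (k - p) ≤ B := fun p => by
    have := hB (P.map ⟨fun k => k - p, fun _ _ h => by simpa using h⟩)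
    simpa [Finset.sum_map] using! this
  calc ∑ k ∈ P, (∑ p ∈ P, b (k - p) * |v p|) ^ 2
      ≤ ∑ k ∈ P, B * ∑ p ∈ P, b (k - p) * v p ^ 2 := by
        refine Finset.sum_le_sum fun k _ => ?_
        -- Cauchy–Schwarz with weights `b (k - p)`.
        refine (Finset.sum_sq_le_sum_mul_sum_of_sq_le_mul P (f := fun p => b (k - p))
          (g := fun p => b (k - p) * v p ^ 2) (fun p _ => hb _)
          (fun p _ => mul_nonneg (hb _) (sq_nonneg _)) (fun p _ => ?_)).trans ?_
        · rw [mul_pow, sq_abs]; exact le_of_eq (by ring)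
        · exact mul_le_mul_of_nonneg_right (hrow k)
            (Finset.sum_nonneg fun p _ => mul_nonneg (hb _) (sq_nonneg _))
    _ = B * ∑ p ∈ P, (∑ k ∈ P, b (k - p)) * v p ^ 2 := by
        rw [← Finset.mul_sum, Finset.sum_comm]
        simp_rw [Finset.sum_mul]
    _ ≤ B * ∑ p ∈ P, B * v p ^ 2 := by
        refine mul_le_mul_of_nonneg_left (Finset.sum_le_sum fun p _ => ?_) hB0
        exact mul_le_mul_of_nonneg_right (hcol p) (sq_nonneg _)
    _ = _ := by rw [← Finset.mul_sum]; ring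

theorem sum_window_shift {L : ℕ} {s : ℤ} (P : Finset ℤ) (f : ℤ → ℝ)
    (hf : ∀ p, p - s ∉ Finset.Ico (0 : ℤ) L → f p = 0) :
    ∑ j ∈ Finset.Ico (0 : ℤ) L, (if j + s ∈ P then f (j + s) else 0) = ∑ p ∈ P, f p := by
  classical
  rw [← Finset.sum_filter,
    ← Finset.sum_filter_of_ne (p := fun p => p - s ∈ Finset.Ico (0 : ℤ) L) (s := P)
      (fun p _ hp => by by_contra h; exact hp (hf p h))]
  refine Finset.sum_nbij' (fun j => j + s) (fun p => p - s) ?_ ?_ ?_ ?_ ?_ <;>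
    simp +contextual

/-- If all sections of length `L` of a Toeplitz operator have gain at most `γ`, then so has any
windowed signal. -/
theorem windowed_gain_le {g : ℤ → ℝ} {L : ℕ} {γ : ℝ}
    (h : ∀ x : ℤ → ℝ, ∑ i ∈ Finset.Ico (0 : ℤ) L,
      (∑ j ∈ Finset.Ico (0 : ℤ) L, g (i - j) * x j) ^ 2 ≤
        γ ^ 2 * ∑ i ∈ Finset.Ico (0 : ℤ) L, x i ^ 2) (P : Finset ℤ) (v : ℤ → ℝ) (s : ℤ) :
    ∑ k ∈ Finset.Ico s (s + L), (∑ p ∈ P, g (k - p) * v p * tentWindow L (p - s)) ^ 2 ≤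
      γ ^ 2 * ∑ p ∈ P, tentWindow L (p - s) ^ 2 * v p ^ 2 := by
  -- Test input: the windowed signal translated back to the origin; the Toeplitz structure is
  -- invariant under this shift.
  have h1 := h fun j => if j + s ∈ P then v (j + s) * tentWindow L j else 0
  have h2 : ∑ i ∈ Finset.Ico (0 : ℤ) L,
      (if i + s ∈ P then v (i + s) * tentWindow L i else 0) ^ 2 =
        ∑ p ∈ P, tentWindow L (p - s) ^ 2 * v p ^ 2 := by
    rw [← sum_window_shift (L := L) (s := s) P _
      fun p hp => by rw [tentWindow_eq_zero hp]; simp]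
    refine Finset.sum_congr rfl fun i _ => ?_
    split_ifs
    · rw [add_sub_cancel_right]; ring
    · simp
  have h3 : ∀ i, ∑ j ∈ Finset.Ico (0 : ℤ) L,
      g (i - j) * (if j + s ∈ P then v (j + s) * tentWindow L j else 0) =
        ∑ p ∈ P, g (i + s - p) * v p * tentWindow L (p - s) := by
    intro i
    rw [← sum_window_shift (L := L) (s := s) P _
      fun p hp => by rw [tentWindow_eq_zero hp]; simp]
    refine Finset.sum_congr rfl fun j _ => ?_
    split_ifs
    · rw [add_sub_cancel_right, add_sub_add_right_eq_sub]; ring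
    · simp
  simp_rw [h2, h3] at h1
  refine le_of_eq_of_le ?_ h1
  refine Finset.sum_nbij' (fun k => k - s) (fun i => i + s) ?_ ?_ ?_ ?_ ?_ <;>
    simp +contextual <;> intros <;> lia

/-- The energy of the windowed outputs outside of the window. -/
theorem sum_sq_window_tail_le (L : ℕ) (P S : Finset ℤ) (g v : ℤ → ℝ) (k : ℤ) :
    ∑ s ∈ S with k ∉ Finset.Ico s (s + (L : ℤ)),
      (∑ p ∈ P, g (k - p) * v p * tentWindow L (p - s)) ^ 2 ≤
        L * (∑ p ∈ P, |g (k - p)| * (1 + ((k - p : ℤ) : ℝ) ^ 2) * |v p|) ^ 2 := by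
  set b : ℤ → ℝ := fun p => |g (k - p)| * (1 + ((k - p : ℤ) : ℝ) ^ 2) * |v p| with hbdef
  have hb : ∀ p, 0 ≤ b p := fun p => by positivity
  set χ : ℤ → ℤ → ℝ := fun p s => if s ∈ Finset.Ioc (p - L) p then (1 : ℝ) else 0 with hχ
  have hχ0 : ∀ p s, 0 ≤ χ p s := fun p s => by simp only [hχ]; split_ifs <;> norm_num
  have hχ1 : ∀ p s, χ p s ≤ 1 := fun p s => by simp only [hχ]; split_ifs <;> norm_num
  have hterm : ∀ s ∈ S.filter fun s => k ∉ Finset.Ico s (s + (L : ℤ)),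
      (∑ p ∈ P, g (k - p) * v p * tentWindow L (p - s)) ^ 2 ≤
        (∑ p ∈ P, b p) * ∑ p ∈ P, b p * χ p s := by
    intro s hs
    -- The window vanishes at `k`, so the Lipschitz bound makes it at most `|k - p|` at `p`, hence
    -- at most the weight `1 + (k - p)²`.
    have hk : tentWindow L (k - s) = 0 := by
      apply tentWindow_eq_zero
      have := (Finset.mem_filter.1 hs).2
      simp at this ⊢; lia
    have hw : ∀ p, |tentWindow L (p - s)| ≤ (1 + ((k - p : ℤ) : ℝ) ^ 2) * χ p s := by
      intro p
      by_cases hp : s ∈ Finset.Ioc (p - L) p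
      · have h1 : |tentWindow L (p - s)| ≤ |((k - p : ℤ) : ℝ)| := by
          have := abs_tentWindow_sub_le L (p - s) (k - s)
          rw [hk, sub_zero] at this
          refine this.trans_eq ?_
          rw [abs_sub_comm]; congr 1; push_cast; ring
        simp only [hχ, if_pos hp, mul_one]
        nlinarith [sq_abs ((k - p : ℤ) : ℝ), sq_nonneg (|((k - p : ℤ) : ℝ)| - 1)]
      · rw [tentWindow_sub_eq_zero hp, abs_zero]
        exact mul_nonneg (by positivity) (hχ0 p s)
    have habs : |∑ p ∈ P, g (k - p) * v p * tentWindow L (p - s)| ≤ ∑ p ∈ P, b p * χ p s := by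
      refine (Finset.abs_sum_le_sum_abs _ _).trans (Finset.sum_le_sum fun p _ => ?_)
      rw [abs_mul, abs_mul]
      calc |g (k - p)| * |v p| * |tentWindow L (p - s)|
          ≤ |g (k - p)| * |v p| * ((1 + ((k - p : ℤ) : ℝ) ^ 2) * χ p s) :=
            mul_le_mul_of_nonneg_left (hw p) (by positivity)
        _ = b p * χ p s := by simp only [hbdef]; ring
    have hle : ∑ p ∈ P, b p * χ p s ≤ ∑ p ∈ P, b p :=
      Finset.sum_le_sum fun p _ => mul_le_of_le_one_right (hb p) (hχ1 p s)
    -- One factor is bounded by the full sum, uniformly in `s`; the other keeps the indicator, so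
    -- that summing over `s` costs only a single factor `L`.
    rw [← sq_abs, sq]
    exact mul_le_mul (habs.trans hle) habs (abs_nonneg _) (Finset.sum_nonneg fun p _ => hb p)
  refine (Finset.sum_le_sum hterm).trans ?_
  rw [← Finset.mul_sum, Finset.sum_comm, sq, mul_left_comm]
  refine mul_le_mul_of_nonneg_left ?_ (Finset.sum_nonneg fun p _ => hb p)
  rw [Finset.mul_sum]
  refine Finset.sum_le_sum fun p _ => ?_
  rw [← Finset.mul_sum, mul_comm]
  exact mul_le_mul_of_nonneg_right (sum_indicator_window_le L _ p) (hb p)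

/-- In the localization identity, `(p - q)² ≤ 2 (1 + (k - p)²)(1 + (k - q)²)` separates the
variables, so the double error sum factors into a square. -/
theorem le_sum_sq_window (L : ℕ) (P S : Finset ℤ) (g v : ℤ → ℝ) (k : ℤ)
    (hS : ∀ p ∈ P, Finset.Ioc (p - L) p ⊆ S) :
    (∑ x ∈ Finset.Ico (0 : ℤ) L, tentWindow L x ^ 2) * (∑ p ∈ P, g (k - p) * v p) ^ 2 -
        2 * L * (∑ p ∈ P, |g (k - p)| * (1 + ((k - p : ℤ) : ℝ) ^ 2) * |v p|) ^ 2 ≤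
      ∑ s ∈ S, (∑ p ∈ P, g (k - p) * v p * tentWindow L (p - s)) ^ 2 := by
  rw [sum_sq_sum_mul_window P S (fun p s => tentWindow L (p - s)) _
    (fun p hp => sum_sq_tentWindow_sub L (hS p hp))]
  refine sub_le_sub_left ?_ _
  rw [sq (∑ p ∈ P, |g (k - p)| * _ * _), Finset.sum_mul_sum, Finset.mul_sum, Finset.mul_sum]
  refine Finset.sum_le_sum fun p _ => ?_
  rw [Finset.mul_sum, Finset.mul_sum]
  refine Finset.sum_le_sum fun q _ => ?_
  set D := ∑ s ∈ S, (tentWindow L (p - s) - tentWindow L (q - s)) ^ 2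
  have hD0 : 0 ≤ D := Finset.sum_nonneg fun s _ => sq_nonneg _
  have hD : D ≤ 4 * L * ((1 + ((k - p : ℤ) : ℝ) ^ 2) * (1 + ((k - q : ℤ) : ℝ) ^ 2)) := by
    refine (sum_sq_tentWindow_sub_sub_le L S p q).trans ?_
    have : ((p : ℝ) - q) ^ 2 ≤
        2 * ((1 + ((k - p : ℤ) : ℝ) ^ 2) * (1 + ((k - q : ℤ) : ℝ) ^ 2)) := by
      push_cast
      nlinarith [sq_nonneg ((k - p : ℝ) + (k - q)), sq_nonneg ((k - p : ℝ) * (k - q))]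
    nlinarith [(Nat.cast_nonneg L : (0 : ℝ) ≤ L)]
  calc 1 / 2 * (g (k - p) * v p * (g (k - q) * v q) * D)
      ≤ 1 / 2 * (|g (k - p) * v p * (g (k - q) * v q)| * D) := by
        gcongr; exact le_abs_self _
    _ ≤ 1 / 2 * (|g (k - p) * v p * (g (k - q) * v q)| *
          (4 * L * ((1 + ((k - p : ℤ) : ℝ) ^ 2) * (1 + ((k - q : ℤ) : ℝ) ^ 2)))) := by gcongr
    _ = _ := by simp only [abs_mul]; ring

/-- The gain of a finite section of length `L` of a Toeplitz operator with rapidly decaying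
coefficients bounds the gain of all sections, up to an error of order `1 / L ^ 2`. -/
theorem toeplitz_gain_le {g : ℤ → ℝ} {B : ℝ}
    (hB : ∀ T : Finset ℤ, ∑ x ∈ T, |g x| * (1 + (x : ℝ) ^ 2) ≤ B) {L : ℕ} (hL : 1 ≤ L) {γ : ℝ}
    (h : ∀ x : ℤ → ℝ, ∑ i ∈ Finset.Ico (0 : ℤ) L,
      (∑ j ∈ Finset.Ico (0 : ℤ) L, g (i - j) * x j) ^ 2 ≤
        γ ^ 2 * ∑ i ∈ Finset.Ico (0 : ℤ) L, x i ^ 2) (P : Finset ℤ) (v : ℤ → ℝ) :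
    ∑ k ∈ P, (∑ p ∈ P, g (k - p) * v p) ^ 2 ≤
      (γ ^ 2 + 144 * B ^ 2 / (L : ℝ) ^ 2) * ∑ p ∈ P, v p ^ 2 := by
  classical
  set R := ∑ x ∈ Finset.Ico (0 : ℤ) L, tentWindow L x ^ 2 with hRdef
  set S : Finset ℤ := P.biUnion fun p => Finset.Ioc (p - L) p with hSdef
  have hS : ∀ p ∈ P, Finset.Ioc (p - L) p ⊆ S := fun p hp =>
    Finset.subset_biUnion_of_mem (fun p : ℤ => Finset.Ioc (p - L) p) hp
  set y : ℤ → ℤ → ℝ := fun k s => ∑ p ∈ P, g (k - p) * v p * tentWindow L (p - s) with hy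
  set a : ℤ → ℝ := fun k => ∑ p ∈ P, |g (k - p)| * (1 + ((k - p : ℤ) : ℝ) ^ 2) * |v p| with ha
  have hyoung : ∑ k ∈ P, a k ^ 2 ≤ B ^ 2 * ∑ p ∈ P, v p ^ 2 :=
    sum_sq_convolution_le P (fun x => |g x| * (1 + (x : ℝ) ^ 2)) v (fun x => by positivity) B hB
  have hwin : ∑ s ∈ S, ∑ k ∈ Finset.Ico s (s + L), y k s ^ 2 ≤ γ ^ 2 * (R * ∑ p ∈ P, v p ^ 2) := by
    refine (Finset.sum_le_sum fun s _ => windowed_gain_le h P v s).trans_eq ?_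
    rw [← Finset.mul_sum, Finset.sum_comm, Finset.mul_sum P _ R]
    congr 1
    refine Finset.sum_congr rfl fun p hp => ?_
    rw [← Finset.sum_mul, sum_sq_tentWindow_sub L (hS p hp)]
  -- Outputs inside the window of `s` are controlled by the section bound, those outside by the tail
  -- estimate.
  have hsplit : ∑ k ∈ P, ∑ s ∈ S, y k s ^ 2 ≤
      ∑ s ∈ S, ∑ k ∈ Finset.Ico s (s + L), y k s ^ 2 + ∑ k ∈ P, L * a k ^ 2 := by
    have h1 : ∀ k ∈ P, ∑ s ∈ S, y k s ^ 2 ≤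
        ∑ s ∈ S with k ∈ Finset.Ico s (s + (L : ℤ)), y k s ^ 2 + L * a k ^ 2 := fun k _ => by
      rw [← Finset.sum_filter_add_sum_filter_not S (fun s => k ∈ Finset.Ico s (s + L))]
      gcongr
      exact sum_sq_window_tail_le L P S g v k
    refine (Finset.sum_le_sum h1).trans ?_
    rw [Finset.sum_add_distrib]
    gcongr
    simp_rw [Finset.sum_filter]
    rw [Finset.sum_comm]
    refine Finset.sum_le_sum fun s _ => ?_
    rw [← Finset.sum_filter]
    refine Finset.sum_le_sum_of_subset_of_nonneg (fun k hk => (Finset.mem_filter.1 hk).2)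
      fun _ _ _ => sq_nonneg _
  have hlow : R * ∑ k ∈ P, (∑ p ∈ P, g (k - p) * v p) ^ 2 - 2 * L * ∑ k ∈ P, a k ^ 2 ≤
      ∑ k ∈ P, ∑ s ∈ S, y k s ^ 2 := by
    rw [Finset.mul_sum, Finset.mul_sum, ← Finset.sum_sub_distrib]
    exact Finset.sum_le_sum fun k _ => le_sum_sq_window L P S g v k hS
  rw [← Finset.mul_sum] at hsplit
  have hLpos : (0 : ℝ) < L := by exact_mod_cast hL
  have hR : (L : ℝ) ^ 3 / 48 ≤ R := le_sum_sq_tentWindow L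
  have hRpos : 0 < R := lt_of_lt_of_le (by positivity) hR
  set V := ∑ p ∈ P, v p ^ 2
  have hV : 0 ≤ V := Finset.sum_nonneg fun p _ => sq_nonneg _
  -- The factor `3 L` is `2 L` from localization plus `L` from the tails; `144 = 3 * 48`.
  have herr : 3 * (L : ℝ) * (B ^ 2 * V) ≤ R * (144 * B ^ 2 / (L : ℝ) ^ 2 * V) := by
    calc 3 * (L : ℝ) * (B ^ 2 * V) = (L : ℝ) ^ 3 / 48 * (144 * B ^ 2 / (L : ℝ) ^ 2 * V) := by
          field_simp; ring
      _ ≤ _ := mul_le_mul_of_nonneg_right hR (by positivity)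
  refine le_of_mul_le_mul_left ?_ hRpos
  nlinarith [mul_le_mul_of_nonneg_left hyoung hLpos.le]

/-! ### Exponentially decaying power series and small gain -/

namespace PowerSeries

/-- The coefficients of `f` decay exponentially: `f` converges absolutely on some closed disc of
radius greater than one. -/
def HasExpDecay (f : PowerSeries ℂ) : Prop :=
  ∃ R : ℝ, 1 < R ∧ Summable fun k => ‖coeff k f‖ * R ^ k

/-- The sum of the power series `f` at the point `ζ`. -/
noncomputable def tsumEval (f : PowerSeries ℂ) (ζ : ℂ) : ℂ := ∑' k, coeff k f * ζ ^ k

theorem summable_norm_coeff_mul_pow_of_le {f : PowerSeries ℂ} {R r : ℝ} (hr : 0 ≤ r) (h : r ≤ R)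
    (hf : Summable fun k => ‖coeff k f‖ * R ^ k) : Summable fun k => ‖coeff k f‖ * r ^ k :=
  hf.of_nonneg_of_le (fun k => by positivity) fun k => by gcongr

theorem summable_norm_eval {f : PowerSeries ℂ} {R : ℝ}
    (hf : Summable fun k => ‖coeff k f‖ * R ^ k) {ζ : ℂ} (hζ : ‖ζ‖ ≤ R) :
    Summable fun k => ‖coeff k f * ζ ^ k‖ := by
  simpa using summable_norm_coeff_mul_pow_of_le (norm_nonneg ζ) hζ hf

theorem coeff_mul_mul_pow {A : Type*} [CommSemiring A] (f g : PowerSeries A) (ζ : A) (k : ℕ) :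
    coeff k (f * g) * ζ ^ k =
      ∑ ij ∈ Finset.HasAntidiagonal.antidiagonal k, coeff ij.1 f * ζ ^ ij.1 * (coeff ij.2 g * ζ ^ ij.2) := by
  rw [coeff_mul, Finset.sum_mul]
  refine Finset.sum_congr rfl fun ij hij => ?_
  rw [← Finset.HasAntidiagonal.mem_antidiagonal.1 hij, pow_add]; ring

theorem tsumEval_mul {f g : PowerSeries ℂ} {R : ℝ}
    (hf : Summable fun k => ‖coeff k f‖ * R ^ k) (hg : Summable fun k => ‖coeff k g‖ * R ^ k)
    {ζ : ℂ} (hζ : ‖ζ‖ ≤ R) : tsumEval (f * g) ζ = tsumEval f ζ * tsumEval g ζ := by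
  rw [tsumEval, tsumEval, tsumEval, tsum_mul_tsum_eq_tsum_sum_antidiagonal_of_summable_norm
    (summable_norm_eval hf hζ) (summable_norm_eval hg hζ)]
  exact tsum_congr fun k => coeff_mul_mul_pow f g ζ k

theorem tsumEval_add {f g : PowerSeries ℂ} {R : ℝ}
    (hf : Summable fun k => ‖coeff k f‖ * R ^ k) (hg : Summable fun k => ‖coeff k g‖ * R ^ k)
    {ζ : ℂ} (hζ : ‖ζ‖ ≤ R) : tsumEval (f + g) ζ = tsumEval f ζ + tsumEval g ζ := by
  rw [tsumEval, tsumEval, tsumEval, ← (summable_norm_eval hf hζ).of_norm.tsum_add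
    (summable_norm_eval hg hζ).of_norm]
  exact tsum_congr fun k => by rw [map_add, add_mul]

theorem summable_norm_coeff_mul {f g : PowerSeries ℂ} {R : ℝ} (hR : 0 ≤ R)
    (hf : Summable fun k => ‖coeff k f‖ * R ^ k) (hg : Summable fun k => ‖coeff k g‖ * R ^ k) :
    Summable fun k => ‖coeff k (f * g)‖ * R ^ k := by
  have hn : ‖(R : ℂ)‖ = R := by simp [abs_of_nonneg hR]
  have := summable_norm_sum_mul_antidiagonal_of_summable_norm
    (summable_norm_eval hf hn.le) (summable_norm_eval hg hn.le)
  refine this.congr fun k => ?_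
  rw [← coeff_mul_mul_pow, norm_mul, norm_pow, hn]

theorem HasExpDecay.exists_common {f g : PowerSeries ℂ} (hf : f.HasExpDecay)
    (hg : g.HasExpDecay) : ∃ R : ℝ, 1 < R ∧ (Summable fun k => ‖coeff k f‖ * R ^ k) ∧
      Summable fun k => ‖coeff k g‖ * R ^ k := by
  obtain ⟨R, hR, hf⟩ := hf
  obtain ⟨R', hR', hg⟩ := hg
  have h : 1 < min R R' := lt_min hR hR'
  exact ⟨min R R', h,
    summable_norm_coeff_mul_pow_of_le (zero_le_one.trans h.le) (min_le_left _ _) hf,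
    summable_norm_coeff_mul_pow_of_le (zero_le_one.trans h.le) (min_le_right _ _) hg⟩

theorem HasExpDecay.mul {f g : PowerSeries ℂ} (hf : f.HasExpDecay) (hg : g.HasExpDecay) :
    (f * g).HasExpDecay := by
  obtain ⟨R, hR, hf, hg⟩ := hf.exists_common hg
  exact ⟨R, hR, summable_norm_coeff_mul (zero_le_one.trans hR.le) hf hg⟩

theorem HasExpDecay.add {f g : PowerSeries ℂ} (hf : f.HasExpDecay) (hg : g.HasExpDecay) :
    (f + g).HasExpDecay := by
  obtain ⟨R, hR, hf, hg⟩ := hf.exists_common hg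
  have hR0 : 0 ≤ R := zero_le_one.trans hR.le
  refine ⟨R, hR, (hf.add hg).of_nonneg_of_le (fun k => by positivity) fun k => ?_⟩
  rw [map_add, ← add_mul]
  gcongr
  exact norm_add_le _ _

theorem summable_norm_coeff_one (R : ℝ) :
    Summable fun k => ‖coeff k (1 : PowerSeries ℂ)‖ * R ^ k :=
  summable_of_ne_finset_zero (s := {0}) fun k hk => by
    rw [coeff_one, if_neg (by simpa using hk)]; simp

theorem tsumEval_one (ζ : ℂ) : tsumEval 1 ζ = 1 := by
  rw [tsumEval, tsum_eq_single 0 fun k hk => by rw [coeff_one, if_neg hk, zero_mul]]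
  simp

theorem HasExpDecay.tsumEval_mul {f g : PowerSeries ℂ} (hf : f.HasExpDecay) (hg : g.HasExpDecay)
    {ζ : ℂ} (hζ : ‖ζ‖ ≤ 1) : tsumEval (f * g) ζ = tsumEval f ζ * tsumEval g ζ := by
  obtain ⟨R, hR, hf, hg⟩ := hf.exists_common hg
  exact PowerSeries.tsumEval_mul hf hg (hζ.trans hR.le)

theorem differentiableOn_tsumEval {f : PowerSeries ℂ} {R : ℝ}
    (hf : Summable fun k => ‖coeff k f‖ * R ^ k) :
    DifferentiableOn ℂ (tsumEval f) (Metric.ball 0 R) := by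
  refine Complex.differentiableOn_tsum_of_summable_norm hf (fun k => by fun_prop)
    Metric.isOpen_ball fun k ζ hζ => ?_
  rw [norm_mul, norm_pow]
  gcongr
  exact (mem_ball_zero_iff.1 hζ).le

theorem hasFPowerSeriesAt_tsumEval {f : PowerSeries ℂ} {R : ℝ} (hR : 0 < R)
    (hf : Summable fun k => ‖coeff k f‖ * R ^ k) :
    HasFPowerSeriesAt (tsumEval f)
      (FormalMultilinearSeries.ofScalars ℂ fun k => coeff k f) 0 := by
  lift R to NNReal using hR.le
  refine ⟨R, ?_, by exact_mod_cast hR, fun {ζ} hζ => ?_⟩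
  · refine FormalMultilinearSeries.le_radius_of_summable_norm _ ?_
    simpa using hf
  · have : ‖ζ‖ ≤ R := by
      simp at hζ
      exact_mod_cast hζ.le
    simpa [FormalMultilinearSeries.ofScalars_apply_eq, tsumEval, mul_comm] using
      (summable_norm_eval hf this).of_norm.hasSum

theorem eq_of_tsumEval_eq {f g : PowerSeries ℂ} {R : ℝ} (hR : 0 < R)
    (hf : Summable fun k => ‖coeff k f‖ * R ^ k) (hg : Summable fun k => ‖coeff k g‖ * R ^ k)
    (h : ∀ ζ ∈ Metric.ball (0 : ℂ) R, tsumEval f ζ = tsumEval g ζ) : f = g := by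
  have := (hasFPowerSeriesAt_tsumEval hR hf).eq_formalMultilinearSeries_of_eventually
    (hasFPowerSeriesAt_tsumEval hR hg)
    (Filter.eventually_of_mem (Metric.ball_mem_nhds 0 hR) h)
  ext k
  exact congrFun (FormalMultilinearSeries.ofScalars_series_injective ℂ ℂ this) k

/-- The Cauchy power series on the disc of radius `ρ` converges absolutely at every strictly smaller
radius. -/
theorem exists_summable_tsumEval_eq {φ : ℂ → ℂ} {ρ r : ℝ} (hr : 0 < r) (hρ : r < ρ)
    (hφ : DifferentiableOn ℂ φ (Metric.closedBall 0 ρ)) :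
    ∃ f : PowerSeries ℂ, (Summable fun k => ‖coeff k f‖ * r ^ k) ∧
      ∀ ζ ∈ Metric.ball (0 : ℂ) r, tsumEval f ζ = φ ζ := by
  lift ρ to NNReal using (hr.trans hρ).le
  lift r to NNReal using hr.le
  have hps := hφ.hasFPowerSeriesOnBall (by exact_mod_cast hr.trans hρ)
  set p := cauchyPowerSeries φ 0 ρ
  refine ⟨PowerSeries.mk fun k => p.coeff k, ?_, fun ζ hζ => ?_⟩
  · have : (r : ENNReal) < p.radius := lt_of_lt_of_le (by exact_mod_cast hρ) hps.r_le
    simpa using p.summable_norm_mul_pow this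
  · have hmem : ζ ∈ Metric.eball (0 : ℂ) ρ := by
      rw [Metric.eball_coe]
      exact Metric.ball_subset_ball hρ.le hζ
    have := (hps.hasSum hmem).tsum_eq
    rw [zero_add] at this
    rw [tsumEval, ← this]
    refine tsum_congr fun k => ?_
    rw [coeff_mk, FormalMultilinearSeries.apply_eq_pow_smul_coeff, smul_eq_mul, mul_comm]

/-- A small-gain theorem: if `F` decays exponentially and is bounded by a constant less than one
on the unit circle, then `1 + F` has an exponentially decaying inverse. -/
theorem HasExpDecay.exists_inverse_one_add {F : PowerSeries ℂ} (hF : F.HasExpDecay) {c : ℝ}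
    (hc : c < 1) (hFc : ∀ ζ : ℂ, ‖ζ‖ = 1 → ‖tsumEval F ζ‖ ≤ c) :
    ∃ K : PowerSeries ℂ, K.HasExpDecay ∧ (1 + F) * K = 1 := by
  obtain ⟨R, hR, hF⟩ := hF
  have hdiff := differentiableOn_tsumEval hF
  -- Maximum modulus carries the bound from the circle to the disc, so `1 + F` has no zero there.
  have hmax : ∀ ζ ∈ Metric.closedBall (0 : ℂ) 1, ‖tsumEval F ζ‖ ≤ c := by
    intro ζ hζ
    refine Complex.norm_le_of_forall_mem_frontier_norm_le (U := Metric.ball 0 1)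
      Metric.isBounded_ball ?_ ?_ ?_
    · refine (hdiff.mono ?_).diffContOnCl
      exact Metric.closure_ball_subset_closedBall.trans (Metric.closedBall_subset_ball hR)
    · intro w hw
      rw [frontier_ball _ one_ne_zero, mem_sphere_zero_iff_norm] at hw
      exact hFc w hw
    · rwa [closure_ball _ one_ne_zero]
  have hopen : IsOpen (Metric.ball (0 : ℂ) R ∩ (fun ζ => 1 + tsumEval F ζ) ⁻¹' {0}ᶜ) :=
    (continuousOn_const.add hdiff.continuousOn).isOpen_inter_preimage Metric.isOpen_ball
      isOpen_compl_singleton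
  -- By compactness `1 + F` stays zero-free on a slightly larger disc; this margin gives the inverse
  -- its exponential decay.
  obtain ⟨δ, hδ, hsub⟩ := (isCompact_closedBall (0 : ℂ) 1).exists_cthickening_subset_open hopen
    (fun ζ hζ => ⟨Metric.closedBall_subset_ball hR hζ, fun h0 => by
      have h1 : tsumEval F ζ = -1 := by
        rw [Set.mem_singleton_iff] at h0; linear_combination h0
      have := hmax ζ hζ
      rw [h1, norm_neg, norm_one] at this
      linarith⟩)
  rw [cthickening_closedBall hδ.le zero_le_one] at hsub
  obtain ⟨r, hr1, hr⟩ := exists_between (show (1 : ℝ) < δ + 1 by linarith)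
  have hr0 : 0 < r := zero_lt_one.trans hr1
  have hinv : DifferentiableOn ℂ (fun ζ => (1 + tsumEval F ζ)⁻¹) (Metric.closedBall 0 (δ + 1)) :=
    ((hdiff.mono fun ζ hζ => (hsub hζ).1).const_add 1).inv fun ζ hζ => (hsub hζ).2
  obtain ⟨K, hK, hKeval⟩ := exists_summable_tsumEval_eq hr0 hr hinv
  have hball : Metric.ball (0 : ℂ) r ⊆ Metric.closedBall 0 (δ + 1) :=
    Metric.ball_subset_closedBall.trans (Metric.closedBall_subset_closedBall hr.le)
  have hrR : r ≤ R := by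
    have hmem : (r : ℂ) ∈ Metric.closedBall (0 : ℂ) (δ + 1) := by
      simp [abs_of_pos hr0, hr.le]
    have := (hsub hmem).1
    simp [abs_of_pos hr0] at this
    exact this.le
  have hFr := summable_norm_coeff_mul_pow_of_le hr0.le hrR hF
  have hFr1 : Summable fun k => ‖coeff k (1 + F)‖ * r ^ k :=
    ((summable_norm_coeff_one r).add hFr).of_nonneg_of_le (fun k => by positivity) fun k => by
      rw [map_add, ← add_mul]
      gcongr
      exact norm_add_le _ _
  refine ⟨K, ⟨r, hr1, hK⟩, eq_of_tsumEval_eq hr0 (summable_norm_coeff_mul hr0.le hFr1 hK)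
    (summable_norm_coeff_one r) fun ζ hζ => ?_⟩
  have hζr : ‖ζ‖ ≤ r := (mem_ball_zero_iff.1 hζ).le
  rw [PowerSeries.tsumEval_mul hFr1 hK hζr, tsumEval_add (summable_norm_coeff_one r) hFr hζr,
    tsumEval_one, hKeval ζ hζ]
  exact mul_inv_cancel₀ (hsub (hball hζ)).2

theorem HasExpDecay.summable_mul_sq {f : PowerSeries ℂ} (hf : f.HasExpDecay) :
    Summable fun k => ‖coeff k f‖ * (1 + (k : ℝ) ^ 2) := by
  obtain ⟨R, hR, hf⟩ := hf
  refine summable_of_isBigO_nat hf ?_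
  refine (isBigO_refl (fun k => ‖coeff k f‖) atTop).mul ?_
  refine IsBigO.add ?_ (isLittleO_pow_const_const_pow_of_one_lt 2 hR).isBigO
  simpa using (isLittleO_pow_const_const_pow_of_one_lt 0 hR).isBigO

end PowerSeries

/-! ### Decay of matrix powers and the resolvent -/

section MatrixDecay

attribute [local instance] Matrix.linftyOpNormedRing Matrix.linftyOpNormedAlgebra

/-- Gelfand's formula, with `r` strictly between the spectral radius and `1`. -/
theorem Matrix.exists_norm_pow_le_of_spectrum {n : ℕ} [NeZero n] (A : Matrix (Fin n) (Fin n) ℂ)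
    (hA : ∀ μ ∈ spectrum ℂ A, ‖μ‖ < 1) :
    ∃ r : NNReal, r < 1 ∧ ∀ᶠ k : ℕ in atTop, ‖A ^ k‖₊ ≤ r ^ k := by
  have hrad : spectralRadius ℂ A < (1 : NNReal) :=
    spectrum.spectralRadius_lt_of_forall_lt A fun z hz => by exact_mod_cast hA z hz
  obtain ⟨r, hr, hr1⟩ := ENNReal.lt_iff_exists_nnreal_btwn.1 hrad
  refine ⟨r, by exact_mod_cast hr1, ?_⟩
  filter_upwards [(spectrum.pow_nnnorm_pow_one_div_tendsto_nhds_spectralRadius A).eventually_lt_const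
    hr, eventually_ge_atTop 1] with k hk hk1
  have hk0 : (k : ℝ) ≠ 0 := by positivity
  have h := ENNReal.rpow_le_rpow hk.le (Nat.cast_nonneg (α := ℝ) k)
  rw [← ENNReal.rpow_mul, one_div_mul_cancel hk0, ENNReal.rpow_one, ENNReal.rpow_natCast] at h
  exact_mod_cast h

theorem Matrix.exists_summable_entry_pow {n : ℕ} (A : Matrix (Fin n) (Fin n) ℂ)
    (hA : ∀ μ ∈ spectrum ℂ A, ‖μ‖ < 1) :
    ∃ R : ℝ, 1 < R ∧ ∀ i j, Summable fun k : ℕ => ‖(A ^ k) i j‖ * R ^ k := by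
  rcases Nat.eq_zero_or_pos n with rfl | hn
  · exact ⟨2, one_lt_two, fun i => i.elim0⟩
  have : NeZero n := ⟨hn.ne'⟩
  obtain ⟨r, hr, hk⟩ := A.exists_norm_pow_le_of_spectrum hA
  obtain ⟨t, hrt, ht⟩ := exists_between hr
  have ht0 : (0 : ℝ) < t := by exact_mod_cast (zero_le (a := r)).trans_lt hrt
  have ht1 : (t : ℝ) < 1 := by exact_mod_cast ht
  have hrt' : (r : ℝ) < t := by exact_mod_cast hrt
  -- Taking `R = 1/t` with `r < t < 1` leaves the convergent ratio `r/t`.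
  refine ⟨(t : ℝ)⁻¹, (one_lt_inv₀ ht0).2 ht1, fun i j => ?_⟩
  have hgeo : Summable fun k : ℕ => ((r : ℝ) / t) ^ k :=
    summable_geometric_of_lt_one (by positivity) ((div_lt_one ht0).2 hrt')
  refine summable_of_isBigO_nat hgeo (IsBigO.of_bound' ?_)
  filter_upwards [hk] with k hk
  have hentry : ‖(A ^ k) i j‖ ≤ ‖A ^ k‖ := by
    have h1 : ‖(A ^ k) i j‖₊ ≤ ∑ j', ‖(A ^ k) i j'‖₊ :=
      Finset.single_le_sum (f := fun j' => ‖(A ^ k) i j'‖₊) (fun _ _ => zero_le)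
        (Finset.mem_univ j)
    have h2 : ∑ j', ‖(A ^ k) i j'‖₊ ≤ ‖A ^ k‖₊ := by
      rw [Matrix.linfty_opNNNorm_def]
      exact Finset.le_sup (f := fun i' => ∑ j', ‖(A ^ k) i' j'‖₊) (Finset.mem_univ i)
    exact_mod_cast h1.trans h2
  have hk' : ‖A ^ k‖ ≤ (r : ℝ) ^ k := by exact_mod_cast hk
  rw [Real.norm_of_nonneg (by positivity), Real.norm_of_nonneg (by positivity), div_pow,
    inv_pow, div_eq_mul_inv]
  gcongr
  exact hentry.trans hk'

end MatrixDecay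

theorem Matrix.hasSum_inv_smul_one_sub {n : ℕ} (A : Matrix (Fin n) (Fin n) ℂ)
    {z : ℂ} (hz : z ≠ 0) (hA : ∀ i j, Summable fun k : ℕ => ‖(A ^ k) i j‖ * ‖z⁻¹‖ ^ k) :
    HasSum (fun k : ℕ => z⁻¹ ^ (k + 1) • A ^ k) (z • (1 : Matrix (Fin n) (Fin n) ℂ) - A)⁻¹ := by
  have hsum : Summable fun k : ℕ => (z⁻¹ • A) ^ k := by
    refine Pi.summable.2 fun i => Pi.summable.2 fun j => .of_norm ?_
    refine (hA i j).congr fun k => ?_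
    rw [smul_pow, Matrix.smul_apply, smul_eq_mul, norm_mul, norm_pow, mul_comm]
  have hinv : (z • (1 : Matrix (Fin n) (Fin n) ℂ) - A)⁻¹ = z⁻¹ • ∑' k : ℕ, (z⁻¹ • A) ^ k := by
    apply Matrix.inv_eq_right_inv
    have : z • (1 : Matrix (Fin n) (Fin n) ℂ) - A = z • (1 - z⁻¹ • A) := by
      rw [smul_sub, smul_inv_smul₀ hz]
    rw [this, smul_mul_smul_comm, mul_inv_cancel₀ hz, one_smul, hsum.one_sub_mul_tsum_pow]
  rw [hinv]
  refine (hsum.hasSum.const_smul z⁻¹).congr_fun ?_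
  intro k
  rw [smul_pow, smul_smul, pow_succ']

/-! ### Impulse responses, transfer functions and trajectories -/

namespace LTISystem

variable {n : ℕ} {m p : Type}

/-- The impulse response from input `b` to output `a` as a power series. -/
def impulseSeries (S : LTISystem n m p) (a : p) (b : m) : PowerSeries ℝ :=
  PowerSeries.mk fun k => S.impulse k a b

theorem map_impulse_succ (S : LTISystem n m p) (k : ℕ) (a : p) (b : m) :
    (S.impulse (k + 1) a b : ℂ) = (S.C.map Complex.ofReal * S.A.map Complex.ofReal ^ k *
      S.B.map Complex.ofReal) a b := by
  have hpow : (S.A ^ k).map Complex.ofReal = S.A.map Complex.ofReal ^ k :=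
    map_pow (RingHom.mapMatrix Complex.ofRealHom) S.A k
  have h1 := Matrix.map_mul (L := S.C * S.A ^ k) (M := S.B) (f := Complex.ofRealHom)
  have h2 := Matrix.map_mul (L := S.C) (M := S.A ^ k) (f := Complex.ofRealHom)
  change ((S.C * S.A ^ k * S.B).map Complex.ofRealHom) a b = _
  rw [h1, h2, ← hpow]
  rfl

theorem IsStable.exists_summable {S : LTISystem n m p} (hS : S.IsStable) :
    ∃ R : ℝ, 1 < R ∧ (∀ i j, Summable fun k : ℕ =>
      ‖(S.A.map Complex.ofReal ^ k) i j‖ * R ^ k) :=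
  Matrix.exists_summable_entry_pow _ hS

theorem IsStable.hasExpDecay {S : LTISystem n m p} (hS : S.IsStable) (a : p) (b : m) :
    (PowerSeries.map Complex.ofRealHom (S.impulseSeries a b)).HasExpDecay := by
  obtain ⟨R, hR, hsum⟩ := hS.exists_summable
  refine ⟨R, hR, (summable_nat_add_iff 1).1 ?_⟩
  have hbound : Summable fun k : ℕ => ∑ j, ∑ i, ‖(S.C a i : ℂ)‖ * ‖(S.B j b : ℂ)‖ * R *
      (‖(S.A.map Complex.ofReal ^ k) i j‖ * R ^ k) :=
    summable_sum fun j _ => summable_sum fun i _ => (hsum i j).mul_left _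
  have hR0 : 0 ≤ R := zero_le_one.trans hR.le
  refine hbound.of_nonneg_of_le (fun k => by positivity) fun k => ?_
  rw [PowerSeries.coeff_map, impulseSeries, PowerSeries.coeff_mk, Complex.ofRealHom_eq_coe,
    map_impulse_succ, Matrix.mul_apply]
  refine (mul_le_mul_of_nonneg_right (norm_sum_le _ _) (by positivity)).trans ?_
  rw [Finset.sum_mul]
  refine Finset.sum_le_sum fun j _ => ?_
  rw [Matrix.mul_apply, norm_mul]
  refine (mul_le_mul_of_nonneg_right (mul_le_mul_of_nonneg_right (norm_sum_le _ _)
    (norm_nonneg _)) (by positivity)).trans (le_of_eq ?_)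
  rw [Finset.sum_mul, Finset.sum_mul]
  refine Finset.sum_congr rfl fun i _ => ?_
  rw [norm_mul, pow_succ, Matrix.map_apply, Matrix.map_apply]
  ring

/-- On the unit circle the transfer function is the sum of the impulse response series at
`z⁻¹`. -/
theorem IsStable.transfer_eq {S : LTISystem n m p} (hS : S.IsStable) {z : ℂ} (hz : ‖z‖ = 1)
    (a : p) (b : m) : S.transfer z a b =
      (PowerSeries.map Complex.ofRealHom (S.impulseSeries a b)).tsumEval z⁻¹ := by
  obtain ⟨R, hR, hsum⟩ := hS.exists_summable
  have hz0 : z ≠ 0 := by rintro rfl; simp at hz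
  have hz' : ‖z⁻¹‖ = 1 := by rw [norm_inv, hz, inv_one]
  have hinv := Matrix.hasSum_inv_smul_one_sub (S.A.map Complex.ofReal) hz0 fun i j =>
    (hsum i j).of_nonneg_of_le (fun k => by positivity) fun k => by rw [hz']; gcongr
  -- A continuous additive map, so it can be applied termwise to the Neumann series of the
  -- resolvent.
  let φ : Matrix (Fin n) (Fin n) ℂ →+ ℂ :=
    { toFun := fun X => (S.C.map Complex.ofReal * X * S.B.map Complex.ofReal) a b
      map_zero' := by simp
      map_add' := fun X Y => by rw [Matrix.mul_add, Matrix.add_mul, Matrix.add_apply] }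
  have hφ : Continuous φ := by
    change Continuous fun X : Matrix (Fin n) (Fin n) ℂ =>
      (S.C.map Complex.ofReal * X * S.B.map Complex.ofReal) a b
    simp only [Matrix.mul_apply]
    fun_prop
  have h1 := hinv.map φ hφ
  have hsummable := (PowerSeries.summable_norm_eval (hS.hasExpDecay a b).choose_spec.2
    (ζ := z⁻¹) (by rw [hz']; exact (hS.hasExpDecay a b).choose_spec.1.le)).of_norm
  rw [PowerSeries.tsumEval, hsummable.tsum_eq_zero_add, transfer, Matrix.add_apply]
  congr 1
  · simp [impulseSeries, impulse]
  · refine h1.tsum_eq.symm.trans (tsum_congr fun k => ?_)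
    rw [PowerSeries.coeff_map, impulseSeries, PowerSeries.coeff_mk, Complex.ofRealHom_eq_coe,
      map_impulse_succ]
    change (S.C.map Complex.ofReal * (z⁻¹ ^ (k + 1) • S.A.map Complex.ofReal ^ k) *
      S.B.map Complex.ofReal) a b = _
    rw [Matrix.mul_smul, Matrix.smul_mul, Matrix.smul_apply, smul_eq_mul, mul_comm]

theorem impulse_block {m' p' : Type} (S : LTISystem n m p) (o : p' → p) (i : m' → m) (k : ℕ) :
    (S.block o i).impulse k = (S.impulse k).submatrix o i := by
  cases k <;> rfl

theorem impulseSeries_block {m' p' : Type} (S : LTISystem n m p) (o : p' → p) (i : m' → m)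
    (a : p') (b : m') : (S.block o i).impulseSeries a b = S.impulseSeries (o a) (i b) := by
  ext k
  simp [impulseSeries, impulse_block]

/-- Signals become power series, so that composing and inverting systems is algebra in a commutative
ring. -/
theorem filter_apply [Fintype m] (S : LTISystem n m p) (w : ℕ → m → ℝ) (k : ℕ) (a : p) :
    S.filter w k a =
      ∑ b, PowerSeries.coeff k (S.impulseSeries a b * PowerSeries.mk fun j => w j b) := by
  simp_rw [mul_comm (S.impulseSeries a _), PowerSeries.coeff_mul,
    Finset.Nat.sum_antidiagonal_eq_sum_range_succ_mk, impulseSeries, PowerSeries.coeff_mk]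
  rw [filter, Finset.sum_apply, Finset.sum_comm]
  refine Finset.sum_congr rfl fun j _ => ?_
  rw [Matrix.mulVec, dotProduct]
  exact Finset.sum_congr rfl fun b _ => mul_comm _ _

/-- The state at time `k` from zero initial condition. -/
def stateResponse [Fintype m] (S : LTISystem n m p) (u : ℕ → m → ℝ) : ℕ → Fin n → ℝ
  | 0 => 0
  | k + 1 => S.A *ᵥ S.stateResponse u k + S.B *ᵥ u k

theorem stateResponse_eq_sum [Fintype m] (S : LTISystem n m p) (u : ℕ → m → ℝ) (k : ℕ) :
    S.stateResponse u k = ∑ j ∈ Finset.range k, (S.A ^ (k - 1 - j) * S.B) *ᵥ u j := by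
  induction k with
  | zero => rfl
  | succ k ih =>
    rw [stateResponse, ih, Finset.sum_range_succ, Matrix.mulVec_sum]
    congr 1
    · refine Finset.sum_congr rfl fun j hj => ?_
      have : k + 1 - 1 - j = k - 1 - j + 1 := by have := Finset.mem_range.1 hj; lia
      rw [this, pow_succ', Matrix.mulVec_mulVec, Matrix.mul_assoc]
    · simp

theorem filter_eq_stateResponse [Fintype m] (S : LTISystem n m p) (u : ℕ → m → ℝ) (k : ℕ) :
    S.filter u k = S.C *ᵥ S.stateResponse u k + S.D *ᵥ u k := by
  rw [filter, Finset.sum_range_succ, stateResponse_eq_sum, Matrix.mulVec_sum]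
  congr 1
  · refine Finset.sum_congr rfl fun j hj => ?_
    have : k - j = k - 1 - j + 1 := by have := Finset.mem_range.1 hj; lia
    rw [this, impulse, Matrix.mulVec_mulVec, Matrix.mul_assoc]
  · simp [impulse]

theorem isTrajectory_filter [Fintype m] (S : LTISystem n m p) (N : ℕ∞) (u : ℕ → m → ℝ) :
    S.IsTrajectory N 0 u (S.filter u) :=
  ⟨S.stateResponse u, rfl, fun k _ => ⟨rfl, S.filter_eq_stateResponse u k⟩⟩

theorem IsTrajectory.eq_filter [Fintype m] {S : LTISystem n m p} {u : ℕ → m → ℝ}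
    {y : ℕ → p → ℝ} (h : S.IsTrajectory ⊤ 0 u y) : y = S.filter u := by
  obtain ⟨x, hx0, hx⟩ := h
  have hstate : ∀ k, x k = S.stateResponse u k := by
    intro k
    induction k with
    | zero => exact hx0
    | succ k ih => rw [(hx k (ENat.natCast_lt_top k)).1, ih, stateResponse]
  funext k
  rw [(hx k (ENat.natCast_lt_top k)).2, hstate, filter_eq_stateResponse]

end LTISystem

/-! ### From squared gains to gains of truncated convolutions -/

namespace PowerSeries

theorem sum_Ico_toeplitz (H : PowerSeries ℝ) (v : ℤ → ℝ) {m k : ℕ} (hk : k < m) :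
    ∑ j ∈ Finset.Ico (0 : ℤ) m,
      (if 0 ≤ (k : ℤ) - j then coeff ((k : ℤ) - j).toNat H else 0) * v j =
        coeff k (H * mk fun j => v j) := by
  rw [Finset.sum_Ico_zero_natCast, mul_comm, coeff_mul,
    Finset.Nat.sum_antidiagonal_eq_sum_range_succ_mk]
  refine (Finset.sum_subset (Finset.range_subset_range.2 hk) fun j _ hj => ?_).symm.trans
    (Finset.sum_congr rfl fun j hj => ?_)
  · rw [if_neg (by simp at hj; lia), zero_mul]
  · have hj := Finset.mem_range.1 hj
    rw [if_pos (by lia), show ((k : ℤ) - j).toNat = k - j by lia]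
    simp [mul_comm]

/-- If the truncated convolution with `H` has gain at most `γ` on signals of length `L`, then its
gain on signals of any length is bounded up to an error of order `1 / L ^ 2`. -/
theorem truncated_gain_le {H : PowerSeries ℝ}
    (hH : Summable fun k => |coeff k H| * (1 + (k : ℝ) ^ 2)) {L : ℕ} (hL : 1 ≤ L) {γ : ℝ}
    (h : ∀ V : PowerSeries ℝ, ∑ k ∈ Finset.range L, coeff k (H * V) ^ 2 ≤
      γ ^ 2 * ∑ k ∈ Finset.range L, coeff k V ^ 2) (m : ℕ) (V : PowerSeries ℝ) :
    ∑ k ∈ Finset.range m, coeff k (H * V) ^ 2 ≤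
      (γ ^ 2 + 144 * (∑' k, |coeff k H| * (1 + (k : ℝ) ^ 2)) ^ 2 / (L : ℝ) ^ 2) *
        ∑ k ∈ Finset.range m, coeff k V ^ 2 := by
  set g : ℤ → ℝ := fun x => if 0 ≤ x then coeff x.toNat H else 0 with hg
  have hsum : ∀ (N : ℕ) (v : ℤ → ℝ), ∑ i ∈ Finset.Ico (0 : ℤ) N,
      (∑ j ∈ Finset.Ico (0 : ℤ) N, g (i - j) * v j) ^ 2 =
        ∑ k ∈ Finset.range N, coeff k (H * mk fun j => v j) ^ 2 := by
    intro N v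
    rw [Finset.sum_Ico_zero_natCast]
    exact Finset.sum_congr rfl fun k hk => by
      rw [← sum_Ico_toeplitz H v (Finset.mem_range.1 hk)]
  have hB : ∀ T : Finset ℤ, ∑ x ∈ T, |g x| * (1 + (x : ℝ) ^ 2) ≤
      ∑' k, |coeff k H| * (1 + (k : ℝ) ^ 2) := by
    intro T
    classical
    calc ∑ x ∈ T, |g x| * (1 + (x : ℝ) ^ 2)
        = ∑ x ∈ T with 0 ≤ x, |g x| * (1 + (x : ℝ) ^ 2) := by
          refine (Finset.sum_filter_of_ne fun x _ hx => ?_).symm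
          by_contra h0
          simp [hg, h0] at hx
      _ = ∑ k ∈ (T.filter fun x => 0 ≤ x).image Int.toNat,
            |coeff k H| * (1 + (k : ℝ) ^ 2) := by
          rw [Finset.sum_image]
          · refine Finset.sum_congr rfl fun x hx => ?_
            have hx0 := (Finset.mem_filter.1 hx).2
            have hcast : ((x.toNat : ℕ) : ℝ) = x := by exact_mod_cast Int.toNat_of_nonneg hx0
            simp [hg, hx0, hcast]
          · intro x hx y hy hxy
            simp at hx hy
            lia
      _ ≤ _ := hH.sum_le_tsum _ fun k _ => by positivity
  have := toeplitz_gain_le hB hL (γ := γ) (fun x => ?_) (Finset.Ico (0 : ℤ) m)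
    fun j => coeff j.toNat V
  · rw [hsum, Finset.sum_Ico_zero_natCast] at this
    have hmk : (mk fun j => coeff j V) = V := by ext; simp
    simpa [hmk] using this
  · rw [hsum, Finset.sum_Ico_zero_natCast]
    simpa using h (mk fun j => x j)

/-- The gain of the truncated convolution with `H` on signals of length `L` determines its gain on
signals of any length up to an additive error of order `1 / L ^ 2`. -/
theorem exists_truncated_gain_le {H : PowerSeries ℝ}
    (hH : Summable fun k => |coeff k H| * (1 + (k : ℝ) ^ 2)) :
    ∃ c : ℝ, 0 ≤ c ∧ ∀ L : ℕ, 1 ≤ L → ∀ γ : ℝ, 0 ≤ γ →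
      (∀ V : PowerSeries ℝ, ∑ k ∈ Finset.range L, coeff k (H * V) ^ 2 ≤
        γ ^ 2 * ∑ k ∈ Finset.range L, coeff k V ^ 2) →
      ∀ (m : ℕ) (V : PowerSeries ℝ), ∑ k ∈ Finset.range m, coeff k (H * V) ^ 2 ≤
        (γ + c * (1 / (L : ℝ) ^ 2)) ^ 2 * ∑ k ∈ Finset.range m, coeff k V ^ 2 := by
  by_cases h0 : H = 0
  · subst h0
    refine ⟨0, le_rfl, fun L _ γ _ _ m V => ?_⟩
    simp only [zero_mul, map_zero, ne_eq, OfNat.ofNat_ne_zero, not_false_eq_true, zero_pow,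
      Finset.sum_const_zero]
    exact mul_nonneg (sq_nonneg _) (Finset.sum_nonneg fun k _ => sq_nonneg _)
  obtain ⟨i, hi⟩ : ∃ i, coeff i H ≠ 0 := by
    by_contra! h
    exact h0 (ext fun i => by rw [h i, map_zero])
  set B := ∑' k, |coeff k H| * (1 + (k : ℝ) ^ 2)
  have hB : 0 ≤ B := tsum_nonneg fun k => by positivity
  have hi' : 0 < |coeff i H| := abs_pos.2 hi
  -- The first summand serves `L > i`, where `γ ≥ |coeff i H|`; the second serves the finitely many
  -- `L ≤ i`.
  refine ⟨144 * B ^ 2 / (2 * |coeff i H|) + 12 * B * i, by positivity, fun L hL γ hγ h m V => ?_⟩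
  refine (truncated_gain_le hH hL h m V).trans (mul_le_mul_of_nonneg_right ?_
    (Finset.sum_nonneg fun k _ => sq_nonneg _))
  have hLpos : (0 : ℝ) < L := by exact_mod_cast hL
  set t := 1 / (L : ℝ) ^ 2 with ht
  have ht0 : 0 < t := by positivity
  change γ ^ 2 + 144 * B ^ 2 / (L : ℝ) ^ 2 ≤ _
  rw [div_eq_mul_one_div, ← ht]
  set c₁ := 144 * B ^ 2 / (2 * |coeff i H|) with hc₁
  have hc₁0 : 0 ≤ c₁ := by positivity
  have hc₂0 : 0 ≤ 12 * B * i := by positivity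
  rcases lt_or_ge i L with hiL | hiL
  · have hγi : |coeff i H| ≤ γ := by
      -- The unit impulse has energy one, and its response contains `coeff i H` within the horizon.
      have h1 := h 1
      have h2 : ∑ k ∈ Finset.range L, coeff k (1 : PowerSeries ℝ) ^ 2 = 1 := by
        rw [Finset.sum_eq_single_of_mem 0 (Finset.mem_range.2 hL) fun k _ hk => by
          rw [coeff_one, if_neg hk]; simp]
        simp
      have h3 := Finset.single_le_sum (f := fun k => coeff k H ^ 2) (fun k _ => sq_nonneg _)
        (Finset.mem_range.2 hiL)
      rw [h2, mul_one, mul_one] at h1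
      exact abs_le_of_sq_le_sq (h3.trans h1) hγ
    have h4 : 144 * B ^ 2 ≤ 2 * γ * c₁ := by
      calc 144 * B ^ 2 = 2 * |coeff i H| * c₁ := by rw [hc₁]; field_simp
        _ ≤ _ := by gcongr
    nlinarith [mul_le_mul_of_nonneg_right h4 ht0.le, mul_nonneg hγ (mul_nonneg hc₂0 ht0.le),
      sq_nonneg ((c₁ + 12 * B * i) * t)]
  -- Here `1 ≤ i / L`, so the error `12 B / L` in the gain is at most `12 B i / L ^ 2`.
  · have h5 : 144 * B ^ 2 * t ≤ (12 * B * i * t) ^ 2 := by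
      have hiL' : (L : ℝ) ≤ i := by exact_mod_cast hiL
      have : 1 ≤ (i : ℝ) ^ 2 * t := by
        rw [ht, mul_one_div, one_le_div (by positivity)]
        gcongr
      calc 144 * B ^ 2 * t ≤ 144 * B ^ 2 * t * ((i : ℝ) ^ 2 * t) :=
            le_mul_of_one_le_right (by positivity) this
        _ = _ := by ring
    have h6 : (12 * B * i * t) ^ 2 ≤ ((c₁ + 12 * B * i) * t) ^ 2 := by
      gcongr
      linarith
    nlinarith [mul_nonneg hγ (mul_nonneg (add_nonneg hc₁0 hc₂0) ht0.le)]

/-- The small-gain inverse is built over `ℂ`; uniqueness of inverses identifies it with the image of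
the real inverse. -/
theorem exists_real_inverse {f : PowerSeries ℝ} {K : PowerSeries ℂ}
    (h : map Complex.ofRealHom f * K = 1) :
    ∃ k : PowerSeries ℝ, f * k = 1 ∧ map Complex.ofRealHom k = K := by
  have hf : constantCoeff f ≠ 0 := by
    intro h0
    have := congrArg constantCoeff h
    rw [map_mul, ← coeff_zero_eq_constantCoeff_apply, coeff_map, coeff_zero_eq_constantCoeff_apply,
      h0] at this
    simp at this
  have hk := PowerSeries.mul_inv_cancel f hf
  refine ⟨f⁻¹, hk, ?_⟩
  have hk' : map Complex.ofRealHom f * map Complex.ofRealHom f⁻¹ = 1 := by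
    rw [← map_mul, hk, map_one]
  exact (left_inv_eq_right_inv (by rw [mul_comm]; exact hk') h)

end PowerSeries

/-! ### Reduction of the IQCs to a Toeplitz gain -/

namespace LTISystem

open PowerSeries

variable {n l d : ℕ}

theorem mk_filter (S : LTISystem n (Fin 1) (Fin 1)) (w : ℕ → Fin 1 → ℝ) :
    (PowerSeries.mk fun k => S.filter w k 0) =
      S.impulseSeries 0 0 * PowerSeries.mk fun k => w k 0 := by
  ext k
  rw [coeff_mk, filter_apply, Fin.sum_univ_one]

/-- Apply the inverse relation to the unit impulse. -/
theorem IsInverse.impulseSeries_mul {T : LTISystem d (Fin 1) (Fin 1)}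
    {S : LTISystem n (Fin 1) (Fin 1)} (h : T.IsInverse S) :
    T.impulseSeries 0 0 * S.impulseSeries 0 0 = 1 := by
  have h1 := h.1 fun k _ => coeff k (1 : PowerSeries ℝ)
  have h2 := T.mk_filter (S.filter fun k _ => coeff k (1 : PowerSeries ℝ))
  rw [h1, mk_filter] at h2
  have h3 : (PowerSeries.mk fun k => coeff k (1 : PowerSeries ℝ)) = 1 := by ext k; simp
  rw [h3, mul_one] at h2
  exact h2.symm

/-- The impulse response series from the input of `G` to the output `a` of `Ψ`. -/
noncomputable def filteredSeries (G : LTISystem n (Fin 1) (Fin 1))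
    (Ψ : LTISystem l (Fin 1 ⊕ Fin 1) (Fin 1 ⊕ Fin 1)) (a : Fin 1 ⊕ Fin 1) : PowerSeries ℝ :=
  Ψ.impulseSeries a (Sum.inl 0) + Ψ.impulseSeries a (Sum.inr 0) * G.impulseSeries 0 0

theorem filteredSignal_filter (G : LTISystem n (Fin 1) (Fin 1))
    (Ψ : LTISystem l (Fin 1 ⊕ Fin 1) (Fin 1 ⊕ Fin 1)) (u : ℕ → Fin 1 → ℝ) (k : ℕ)
    (a : Fin 1 ⊕ Fin 1) : filteredSignal Ψ u (G.filter u) k a =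
      coeff k (filteredSeries G Ψ a * PowerSeries.mk fun j => u j 0) := by
  rw [filteredSignal, filter_apply, Fintype.sum_sum_type, Fin.sum_univ_one, Fin.sum_univ_one]
  simp only [Sum.elim_inl, Sum.elim_inr]
  rw [mk_filter, ← map_add, filteredSeries, add_mul, mul_assoc]

theorem dotProduct_gainMatrix_mulVec (γ : ℝ) (r : Fin 1 ⊕ Fin 1 → ℝ) :
    r ⬝ᵥ gainMatrix γ *ᵥ r = γ ^ 2 * r (Sum.inl 0) ^ 2 - r (Sum.inr 0) ^ 2 := by
  simp [gainMatrix, dotProduct, Matrix.mulVec, Matrix.fromBlocks]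
  ring

theorem sum_gainMatrix_filter (G : LTISystem n (Fin 1) (Fin 1))
    (Ψ : LTISystem l (Fin 1 ⊕ Fin 1) (Fin 1 ⊕ Fin 1)) (u : ℕ → Fin 1 → ℝ) (γ : ℝ) (N : ℕ) :
    ∑ k ∈ Finset.range N, filteredSignal Ψ u (G.filter u) k ⬝ᵥ
        gainMatrix γ *ᵥ filteredSignal Ψ u (G.filter u) k =
      γ ^ 2 * ∑ k ∈ Finset.range N,
          coeff k (filteredSeries G Ψ (Sum.inl 0) * PowerSeries.mk fun j => u j 0) ^ 2 -
        ∑ k ∈ Finset.range N,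
          coeff k (filteredSeries G Ψ (Sum.inr 0) * PowerSeries.mk fun j => u j 0) ^ 2 := by
  simp_rw [dotProduct_gainMatrix_mulVec, filteredSignal_filter]
  rw [Finset.sum_sub_distrib, Finset.mul_sum]

/-- Under the small-gain condition, the map from the input to the first filtered signal has a
stable causal inverse. -/
theorem exists_inverse_filteredSeries {G : LTISystem n (Fin 1) (Fin 1)} (hG : G.IsStable)
    {Ψ : LTISystem l (Fin 1 ⊕ Fin 1) (Fin 1 ⊕ Fin 1)} (hΨ : Ψ.IsStable)
    {Φ : LTISystem d (Fin 1) (Fin 1)} (hΦ : Φ.IsStable)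
    (hinv : Φ.IsInverse (Ψ.block Sum.inl Sum.inl))
    (hnorm : hInfNorm (fun z => (Ψ.block Sum.inl Sum.inr).sisoTransfer z *
      G.sisoTransfer z * Φ.sisoTransfer z) < 1) :
    ∃ T : PowerSeries ℝ, (PowerSeries.map Complex.ofRealHom T).HasExpDecay ∧
      filteredSeries G Ψ (Sum.inl 0) * T = 1 := by
  have hΦΨ := hinv.impulseSeries_mul
  rw [impulseSeries_block] at hΦΨ
  have hΨ' : (Ψ.block Sum.inl Sum.inr : LTISystem l (Fin 1) (Fin 1)).IsStable := hΨ
  have d₁ := hΨ'.hasExpDecay 0 0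
  have d₂ := hG.hasExpDecay 0 0
  have d₃ := hΦ.hasExpDecay 0 0
  set F := PowerSeries.map Complex.ofRealHom
    ((Ψ.block Sum.inl Sum.inr : LTISystem l (Fin 1) (Fin 1)).impulseSeries 0 0) *
      PowerSeries.map Complex.ofRealHom (G.impulseSeries 0 0) *
      PowerSeries.map Complex.ofRealHom (Φ.impulseSeries 0 0) with hFdef
  have hF : F.HasExpDecay := (d₁.mul d₂).mul d₃
  have hbound : ∀ ζ : ℂ, ‖ζ‖ = 1 → ‖tsumEval F ζ‖ ≤ (hInfNorm fun z =>
      (Ψ.block Sum.inl Sum.inr).sisoTransfer z * G.sisoTransfer z * Φ.sisoTransfer z).toReal := by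
    intro ζ hζ
    -- The series variable is the delay, so `ζ` on the circle corresponds to `z = ζ⁻¹`.
    have hζ' : ‖ζ⁻¹‖ = 1 := by rw [norm_inv, hζ, inv_one]
    rw [hFdef, (d₁.mul d₂).tsumEval_mul d₃ hζ.le, d₁.tsumEval_mul d₂ hζ.le]
    have e₁ := hΨ'.transfer_eq hζ' 0 0
    have e₂ := hG.transfer_eq hζ' 0 0
    have e₃ := hΦ.transfer_eq hζ' 0 0
    rw [inv_inv] at e₁ e₂ e₃
    rw [← e₁, ← e₂, ← e₃, ← toReal_enorm]
    refine ENNReal.toReal_mono (hnorm.trans ENNReal.one_lt_top).ne ?_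
    exact le_iSup (fun z : Circle => ‖(Ψ.block Sum.inl Sum.inr).sisoTransfer z *
      G.sisoTransfer z * Φ.sisoTransfer z‖ₑ) ⟨ζ⁻¹, mem_sphere_zero_iff_norm.2 hζ'⟩
  have hlt : (hInfNorm fun z => (Ψ.block Sum.inl Sum.inr).sisoTransfer z *
      G.sisoTransfer z * Φ.sisoTransfer z).toReal < 1 := by
    simpa using (ENNReal.toReal_lt_toReal (hnorm.trans ENNReal.one_lt_top).ne
      ENNReal.one_ne_top).2 hnorm
  obtain ⟨Kc, hKc, hKinv⟩ := hF.exists_inverse_one_add hlt hbound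
  rw [hFdef, ← map_mul, ← map_mul, ← map_one (PowerSeries.map Complex.ofRealHom), ← map_add] at hKinv
  rw [map_one] at hKinv
  obtain ⟨K, hK, rfl⟩ := exists_real_inverse hKinv
  -- `(Ψ₁₁ + Ψ₁₂ G) Φ K = (1 + Ψ₁₂ G Φ) K = 1`.
  refine ⟨Φ.impulseSeries 0 0 * K, ?_, ?_⟩
  · rw [map_mul]
    exact d₃.mul hKc
  · rw [impulseSeries_block] at hK
    rw [filteredSeries]
    linear_combination hK + K * hΦΨ

end LTISystem

open LTISystem PowerSeries in
theorem mainTheorem3 {n l d : ℕ}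
    (G : LTISystem n (Fin 1) (Fin 1)) (hGmin : G.IsMinimal) (hG : G.IsStable)
    (Ψ : LTISystem l (Fin 1 ⊕ Fin 1) (Fin 1 ⊕ Fin 1)) (hΨ : Ψ.IsStable)
    (Φ : LTISystem d (Fin 1) (Fin 1)) (hΦ : Φ.IsStable)
    (hinv : Φ.IsInverse (Ψ.block Sum.inl Sum.inl))
    (hnorm : hInfNorm (fun z => (Ψ.block Sum.inl Sum.inr).sisoTransfer z *
      G.sisoTransfer z * Φ.sisoTransfer z) < 1) :
    ∃ ε : ℕ → ℝ, (∀ L, 0 ≤ ε L) ∧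
      ε =O[atTop] (fun L : ℕ => 1 / (L : ℝ) ^ 2) ∧
      ∀ L : ℕ, 1 ≤ L → ∀ γ : ℝ, 0 ≤ γ →
        G.SatisfiesFiniteIQC Ψ (gainMatrix γ) L →
          G.SatisfiesIQC Ψ (gainMatrix (γ + ε L)) := by
  obtain ⟨T, hT, hQT⟩ := exists_inverse_filteredSeries hG hΨ hΦ hinv hnorm
  set Q := filteredSeries G Ψ (Sum.inl 0) with hQ
  set E := filteredSeries G Ψ (Sum.inr 0) with hE
  have hH : (PowerSeries.map Complex.ofRealHom (E * T)).HasExpDecay := by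
    rw [hE, filteredSeries, map_mul, map_add, map_mul]
    exact ((hΨ.hasExpDecay _ _).add ((hΨ.hasExpDecay _ _).mul (hG.hasExpDecay _ _))).mul hT
  obtain ⟨c, hc, hgain⟩ := exists_truncated_gain_le (H := E * T)
    (hH.summable_mul_sq.congr fun k => by
      rw [coeff_map, Complex.ofRealHom_eq_coe, Complex.norm_real, Real.norm_eq_abs])
  refine ⟨fun L => c * (1 / (L : ℝ) ^ 2), fun L => by positivity,
    (isBigO_refl _ _).const_mul_left c, fun L hL γ hγ hfin u y _ htraj h => ?_⟩
  have hgain := hgain L hL γ hγ fun V => by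
    -- The input `T V` makes the filtered signals `V` and `H V`; the last admissible `h = L - 1`
    -- covers the whole horizon.
    have hV := hfin (fun k _ => coeff k (T * V)) _ (G.isTrajectory_filter L _) (L - 1) (by lia)
    rw [Nat.sub_add_cancel hL, sum_gainMatrix_filter] at hV
    have hmk : (PowerSeries.mk fun j => coeff j (T * V)) = T * V := by ext; simp
    rw [hmk, ← hQ, ← hE, ← mul_assoc, ← mul_assoc, hQT, one_mul] at hV
    linarith
  -- Conversely, with `V = Q u` the output `E T Q u` is `E u`.
  have hU := hgain (h + 1) (Q * PowerSeries.mk fun j => u j 0)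
  rw [show E * T * (Q * PowerSeries.mk fun j => u j 0) = E * PowerSeries.mk fun j => u j 0 by
    linear_combination (E * PowerSeries.mk fun j => u j 0) * hQT] at hU
  rw [htraj.eq_filter, sum_gainMatrix_filter]
  linarith
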